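/- Let $H$ be a real Hilbert space, let $a\le b$, let $C\colon[a,b]\rightrightarrows H$ be a set-valued map with nonempty, closed, convex and bounded values, let $x_0\in H$ and let $x\colon[a,b]\to H$. Consider the sweeping process $\dot x(t)\in -N_{C(t)}(x(t))$, $x(a)=x_0$, where $N_S(p)=\{\zeta\in H:\langle\zeta,y-p\rangle\le 0\ \text{for all } y\in S\}$ for $p\in S$ (and $N_S(p)=\emptyset$ for $p\notin S$). Both notions of solution below require (a) that $x$ has bounded variation on $[a,b]$, is right continuous, and satisfies $x(a)=x_0$ and $x(t)\in C(t)$ for all $t\in[a,b]$; and (b) that there is a positive Radon measure $\nu$ on $[a,b]$ with respect to which the differential measure $dx$ of $x$ (the $H$-valued Borel measure on $[a,b]$ with $dx(\{a\})=0$ and $dx((s,t])=x(t)-x(s)$ for $a\le s\le t\le b$) is absolutely continuous, with a density $\frac{dx}{d\nu}\in L^1_\nu([a,b],H)$, and such that * for a *solution in the sense of differential measures*: $\frac{dx}{d\nu}(t)\in -N_{C(t)}(x(t))$ for $\nu$-a.e. $t\in[a,b]$; * for an *integral solution*: $\displaystyle\int_{[a,b]}\Big\langle\frac{dx}{d\nu}(t),\,y(t)-x(t)\Big\rangle\,d\nu(t)\ge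 0$ for every continuous $y\colon[a,b]\to H$ with $y(t)\in C(t)$ for $\nu$-a.e. $t\in[a,b]$. **Theorem.** If $x$ is a solution in the sense of differential measures, then $x$ is an integral solution. If moreover $C$ is lower semicontinuous, i.e. $\{t\in[a,b]: C(t)\cap V\neq\emptyset\}$ is relatively open in $[a,b]$ for every open $V\subset H$ (for instance, if $C$ is continuous, or Lipschitz, for the Hausdorff distance), then $x$ is an integral solution if and only if $x$ is a solution in the sense of differential measures. -/

import Mathlib

open Set MeasureTheory Topology
open scoped RealInnerProductSpace

namespace SweepingProcess

variable {H : Type*} [NormedAddCommGroup H] [InnerProductSpace ℝ H]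

/-- Closed subintervals of the compact interval `[a, b]` are compact. -/
instance instCompactIccSpaceIcc (a b : ℝ) : CompactIccSpace (Icc a b) :=
  ⟨fun {_ _} => isClosed_Icc.isCompact⟩

/-- The normal cone `N_S(p)` of convex analysis to the convex set `S` at `p`, that is the
subdifferential at `p` of the indicator function of `S`; it is empty when `p ∉ S`. -/
def normalCone (S : Set H) (p : H) : Set H :=
  {ζ | p ∈ S ∧ ∀ y ∈ S, ⟪ζ, y - p⟫ ≤ 0}

/-- `x : [a, b] → H` has bounded variation, is right continuous, starts at `x₀` and stays in the
moving set `C`. -/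
structure IsTrajectory {a b : ℝ} (hab : a ≤ b) (C : Icc a b → Set H) (x₀ : H)
    (x : Icc a b → H) : Prop where
  boundedVariation : BoundedVariationOn x univ
  rightContinuous : ∀ t, ContinuousWithinAt x (Ici t) t
  initial : x ⟨a, left_mem_Icc.2 hab⟩ = x₀
  mem : ∀ t, x t ∈ C t

/-- The differential measure `dx` of the function of bounded variation `x : [a, b] → H` is
absolutely continuous with respect to `ν`, with density `v ∈ L¹_ν([a, b], H)`.
Here `dx` is the Stieltjes measure of `x`: for a right continuous `x` it is the `H`-valued Borel
measure on `[a, b]` with `dx (s, t] = x t - x s` and `dx {a} = 0`. -/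
def HasDifferentialDensity [CompleteSpace H] {a b : ℝ} {x : Icc a b → H}
    (hx : BoundedVariationOn x univ) (ν : Measure (Icc a b)) (v : Icc a b → H) : Prop :=
  Integrable v ν ∧ hx.vectorMeasure = ν.withDensityᵥ v

/-- Solutions of the sweeping process `x' ∈ -N_{C(t)}(x)`, `x(a) = x₀`, in the sense of
differential measures. -/
def IsDifferentialMeasureSolution [CompleteSpace H] {a b : ℝ} (hab : a ≤ b)
    (C : Icc a b → Set H) (x₀ : H) (x : Icc a b → H) : Prop :=
  ∃ hx : IsTrajectory hab C x₀ x, ∃ ν : Measure (Icc a b), ν.Regular ∧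
    ∃ v : Icc a b → H, HasDifferentialDensity hx.boundedVariation ν v ∧
      ∀ᵐ t ∂ν, -v t ∈ normalCone (C t) (x t)

/-- Integral solutions of the sweeping process `x' ∈ -N_{C(t)}(x)`, `x(a) = x₀`. -/
def IsIntegralSolution [CompleteSpace H] {a b : ℝ} (hab : a ≤ b)
    (C : Icc a b → Set H) (x₀ : H) (x : Icc a b → H) : Prop :=
  ∃ hx : IsTrajectory hab C x₀ x, ∃ ν : Measure (Icc a b), ν.Regular ∧
    ∃ v : Icc a b → H, HasDifferentialDensity hx.boundedVariation ν v ∧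
      ∀ y : C(Icc a b, H), (∀ᵐ t ∂ν, y t ∈ C t) → 0 ≤ ∫ t, ⟪v t, y t - x t⟫ ∂ν

end SweepingProcess

/-!
A solution in the sense of differential measures satisfies `⟪v t, y t - x t⟫ ≥ 0` for almost every
`t` and every `y` with `y t ∈ C t` almost everywhere, and integrating gives an integral solution.

For the converse the measure `ν` and the density `v` are kept, and the integral inequality for
continuous selections of the lower hemicontinuous map `C` is turned into a pointwise one.

* Michael's theorem extends a continuous selection given on a closed set to the whole interval,
  with control of its distance to a fixed continuous selection
  (`LowerHemicontinuous.exists_continuous_selection_extension`). The control matters because `C` is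
  not assumed to be uniformly bounded.
* Together with Lusin's theorem and the absolute continuity of `∫ ‖v‖ dν`, this shows that the
  integral inequality persists for bounded measurable selections
  (`LowerHemicontinuous.integral_inner_nonneg_of_stronglyMeasurable`). The trajectory `x` is itself
  such a selection, being of bounded variation.
* For a continuous selection `y`, testing with the measurable selection equal to `y` where
  `⟪v, y - x⟫ < 0` and to `x` elsewhere yields `⟪v, y - x⟫ ≥ 0` almost everywhere
  (`LowerHemicontinuous.ae_inner_nonneg_of_continuous_selection`).
* Every point of every `C t` lies on a continuous selection, and a Lindelöf argument in the
  separable range of `t ↦ (t, v t, x t)` reduces to countably many selections, so that one null set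
  serves for all points of `C t` (`LowerHemicontinuous.ae_forall_mem_inner_nonneg`).
-/

open Filter

/-! ### Continuous selections -/

theorem LowerHemicontinuous.closure {X E : Type*} [TopologicalSpace X] [TopologicalSpace E]
    {F : X → Set E} (hF : LowerHemicontinuous F) : LowerHemicontinuous fun t => closure (F t) := by
  rw [lowerHemicontinuous_iff_isOpen_inter_nonempty] at hF ⊢
  intro u hu
  simpa only [closure_inter_open_nonempty_iff hu] using hF u hu

theorem LowerHemicontinuous.piecewise_singleton {X E : Type*} [TopologicalSpace X]
    [TopologicalSpace E] {F : X → Set E} (hF : LowerHemicontinuous F) {K : Set X}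
    [∀ t, Decidable (t ∈ K)] (hK : IsClosed K) {f : X → E} (hf : ContinuousOn f K)
    (hfF : ∀ t ∈ K, f t ∈ F t) :
    LowerHemicontinuous (K.piecewise (fun t => {f t}) F) := by
  rw [lowerHemicontinuous_iff]
  intro t₀
  rw [lowerHemicontinuousAt_iff]
  intro u hu hne
  by_cases ht₀ : t₀ ∈ K
  · have hfu : f t₀ ∈ u := by simpa [ht₀] using hne
    have h₁ := lowerHemicontinuousAt_iff.1 (lowerHemicontinuous_iff.1 hF t₀) u hu
      ⟨f t₀, hfF t₀ ht₀, hfu⟩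
    have h₂ := eventually_nhdsWithin_iff.1 ((hf t₀ ht₀).eventually_mem (hu.mem_nhds hfu))
    filter_upwards [h₁, h₂] with t h₁ h₂
    by_cases ht : t ∈ K
    · simpa [ht] using h₂ ht
    · simpa [ht] using h₁
  · rw [piecewise_eq_of_notMem _ _ _ ht₀] at hne
    filter_upwards [lowerHemicontinuousAt_iff.1 (lowerHemicontinuous_iff.1 hF t₀) u hu hne,
      hK.isOpen_compl.mem_nhds ht₀] with t h₁ (ht : t ∉ K)
    simpa [ht] using h₁

theorem LowerHemicontinuous.inter_ball {X E : Type*} [TopologicalSpace X] [PseudoMetricSpace E]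
    {F : X → Set E} (hF : LowerHemicontinuous F) {g : X → E} (hg : Continuous g) (r : ℝ) :
    LowerHemicontinuous fun t => F t ∩ Metric.ball (g t) r := by
  refine hF.inter_hasOpenCGraph ?_
  have : IsOpen {p : X × E | dist p.2 (g p.1) < r} :=
    isOpen_lt (continuous_snd.dist (hg.comp continuous_fst)) continuous_const
  exact this

section Michael

variable {X E : Type*} [TopologicalSpace X] [NormalSpace X] [ParacompactSpace X]
  [NormedAddCommGroup E] [NormedSpace ℝ E]

/-- Approximate selections come from a partition of unity: the values within `ε` of a point of
`F t` form a convex set, and lower hemicontinuity makes each of them admissible on a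
neighbourhood. -/
theorem LowerHemicontinuous.exists_continuous_approx_selection {F : X → Set E}
    (hF : LowerHemicontinuous F) (hne : ∀ t, (F t).Nonempty) (hconv : ∀ t, Convex ℝ (F t))
    {ε : ℝ} (hε : 0 < ε) : ∃ g : C(X, E), ∀ t, (F t ∩ Metric.ball (g t) ε).Nonempty := by
  obtain ⟨g, hg⟩ := exists_continuous_forall_mem_convex_of_local_const
    (t := fun t => Metric.thickening ε (F t)) (fun t => (hconv t).thickening ε) fun t₀ => by
      obtain ⟨z, hz⟩ := hne t₀
      refine ⟨z, ?_⟩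
      filter_upwards [lowerHemicontinuousAt_iff.1 (lowerHemicontinuous_iff.1 hF t₀) _
        Metric.isOpen_ball ⟨z, hz, Metric.mem_ball_self hε⟩] with t ⟨w, hw, hwz⟩
      exact Metric.mem_thickening_iff.2 ⟨w, hw, Metric.mem_ball'.1 hwz⟩
  refine ⟨g, fun t => ?_⟩
  obtain ⟨w, hw, hwg⟩ := Metric.mem_thickening_iff.1 (hg t)
  exact ⟨w, hw, Metric.mem_ball'.2 hwg⟩

/-- **Michael's selection theorem** for maps with values in a Banach space. -/
theorem LowerHemicontinuous.exists_continuous_selection [CompleteSpace E] {F : X → Set E}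
    (hF : LowerHemicontinuous F) (hne : ∀ t, (F t).Nonempty) (hconv : ∀ t, Convex ℝ (F t))
    (hclosed : ∀ t, IsClosed (F t)) : ∃ g : C(X, E), ∀ t, g t ∈ F t := by
  let A : ℕ → Type _ := fun n =>
    {g : C(X, E) // ∀ t, (F t ∩ Metric.ball (g t) ((1 / 2) ^ n)).Nonempty}
  have step : ∀ n (g : A n), ∃ g' : A (n + 1), ∀ t, dist (g.1 t) (g'.1 t) ≤ 2 * (1 / 2) ^ n := by
    rintro n ⟨g, hg⟩
    obtain ⟨g', hg'⟩ :=
      (hF.inter_ball g.continuous ((1 / 2) ^ n)).exists_continuous_approx_selection hg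
      (fun t => (hconv t).inter (convex_ball _ _))
      (show (0 : ℝ) < (1 / 2) ^ (n + 1) by positivity)
    refine ⟨⟨g', fun t => ?_⟩, fun t => ?_⟩
    · obtain ⟨w, hw, hw'⟩ := hg' t
      exact ⟨w, hw.1, hw'⟩
    · obtain ⟨w, ⟨-, hw⟩, hw'⟩ := hg' t
      have h₁ : dist w (g t) < (1 / 2) ^ n := hw
      have h₂ : dist w (g' t) < (1 / 2) ^ (n + 1) := hw'
      have h₃ : (1 / 2 : ℝ) ^ (n + 1) ≤ (1 / 2) ^ n :=
        pow_le_pow_of_le_one (by norm_num) (by norm_num) n.le_succ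
      have := dist_triangle_left (g t) (g' t) w
      change dist (g t) (g' t) ≤ _
      linarith
  choose next hnext using step
  obtain ⟨g₀, hg₀⟩ := hF.exists_continuous_approx_selection hne hconv
    (show (0 : ℝ) < (1 / 2) ^ 0 by positivity)
  let s : ∀ n, A n := fun n => Nat.rec ⟨g₀, hg₀⟩ next n
  have hs : ∀ t n, dist ((s n).1 t) ((s (n + 1)).1 t) ≤ 2 * (1 / 2) ^ n :=
    fun t n => hnext n (s n) t
  have hlim : ∀ t, ∃ z, Tendsto (fun n => (s n).1 t) atTop (𝓝 z) := fun t =>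
    cauchySeq_tendsto_of_complete (cauchySeq_of_le_geometric _ _ (by norm_num) (hs t))
  choose g hg using hlim
  have hunif : TendstoUniformly (fun n t => (s n).1 t) g atTop := by
    rw [Metric.tendstoUniformly_iff]
    intro ε hε
    have : Tendsto (fun n : ℕ => 2 * (1 / 2 : ℝ) ^ n / (1 - 1 / 2)) atTop (𝓝 0) := by
      simpa using ((tendsto_pow_atTop_nhds_zero_of_lt_one (r := (1 / 2 : ℝ)) (by norm_num)
        (by norm_num)).const_mul 2).div_const (1 - 1 / 2)
    filter_upwards [this.eventually_lt_const hε] with n hn t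
    rw [dist_comm]
    exact (dist_le_of_le_geometric_of_tendsto _ _ (by norm_num) (hs t) (hg t) n).trans_lt hn
  refine ⟨⟨g, hunif.continuous (Frequently.of_forall fun n => (s n).1.continuous)⟩, fun t => ?_⟩
  -- the points of `F t` within `2⁻ⁿ` of the `n`-th approximation have the same limit
  choose w hwF hw using fun n => (s n).2 t
  refine (hclosed t).mem_of_tendsto (b := atTop) (f := w) ?_ (Eventually.of_forall hwF)
  refine (tendsto_iff_of_dist ?_).1 (hg t)
  refine squeeze_zero (fun _ => dist_nonneg) (fun n => ?_)
    (tendsto_pow_atTop_nhds_zero_of_lt_one (r := (1 / 2 : ℝ)) (by norm_num) (by norm_num))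
  rw [dist_comm]
  exact (Metric.mem_ball.1 (hw n)).le

/-- A continuous selection given on a closed set extends to the whole space, and the extension
stays as close to a reference selection `y₀` as the partial selection does. -/
theorem LowerHemicontinuous.exists_continuous_selection_extension [CompleteSpace E]
    {F : X → Set E} (hF : LowerHemicontinuous F) (hconv : ∀ t, Convex ℝ (F t))
    (hclosed : ∀ t, IsClosed (F t)) {y₀ : C(X, E)} (hy₀ : ∀ t, y₀ t ∈ F t)
    {K : Set X} (hK : IsClosed K) {f : X → E} (hf : ContinuousOn f K) (hfF : ∀ t ∈ K, f t ∈ F t)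
    {R : ℝ} (hR : 0 < R) (hfR : ∀ t ∈ K, dist (f t) (y₀ t) < R) :
    ∃ y : C(X, E), (∀ t, y t ∈ F t) ∧ EqOn y f K ∧ ∀ t, dist (y t) (y₀ t) ≤ R := by
  classical
  let G : X → Set E := fun t => _root_.closure (F t ∩ Metric.ball (y₀ t) R)
  have hG : LowerHemicontinuous G := (hF.inter_ball y₀.continuous R).closure
  have hfG : ∀ t ∈ K, f t ∈ G t := fun t ht => subset_closure ⟨hfF t ht, hfR t ht⟩
  obtain ⟨y, hy⟩ := (hG.piecewise_singleton hK hf hfG).exists_continuous_selection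
    (fun t => by
      by_cases ht : t ∈ K
      · simp [ht]
      · simpa [ht] using ⟨y₀ t, subset_closure ⟨hy₀ t, Metric.mem_ball_self hR⟩⟩)
    (fun t => by
      by_cases ht : t ∈ K
      · simp [ht]
      · simpa [ht, G] using ((hconv t).inter (convex_ball _ _)).closure)
    (fun t => by
      by_cases ht : t ∈ K
      · simp [ht]
      · simp [ht, G])
  have hyK : EqOn y f K := fun t ht => by simpa [ht] using hy t
  have hyG : ∀ t, y t ∈ G t := fun t => by
    by_cases ht : t ∈ K
    · rw [hyK ht]
      exact hfG t ht
    · simpa [ht] using hy t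
  refine ⟨y, fun t => ?_, hyK, fun t => ?_⟩
  · exact closure_minimal inter_subset_left (hclosed t) (hyG t)
  · exact closure_minimal (inter_subset_right.trans Metric.ball_subset_closedBall)
      Metric.isClosed_closedBall (hyG t)

end Michael

/-! ### Lusin's theorem and functions of bounded variation -/

/-- **Lusin's theorem** for integrable functions: convergence in mean of continuous functions,
along a subsequence almost everywhere, is uniform off a small set by Egorov's theorem. -/
theorem MeasureTheory.Integrable.exists_isClosed_continuousOn {X E : Type*} [TopologicalSpace X]
    [NormalSpace X] [MeasurableSpace X] [BorelSpace X] [NormedAddCommGroup E] [NormedSpace ℝ E]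
    [SecondCountableTopologyEither X E] {μ : Measure X} [IsFiniteMeasure μ] [μ.WeaklyRegular]
    {f : X → E} (hf : Integrable f μ) (hfm : StronglyMeasurable f) {ε : ℝ} (hε : 0 < ε) :
    ∃ K, IsClosed K ∧ μ Kᶜ ≤ ENNReal.ofReal ε ∧ ContinuousOn f K := by
  have happrox : ∀ n : ℕ, ∃ g : BoundedContinuousFunction X E,
      eLpNorm (f - (g : X → E)) 1 μ ≤ ((n : ENNReal) + 1)⁻¹ ∧ MemLp g 1 μ := fun n =>
    (memLp_one_iff_integrable.2 hf).exists_boundedContinuous_eLpNorm_sub_le ENNReal.one_ne_top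
      (by simp)
  choose g hg _ using happrox
  have hgm : ∀ n, StronglyMeasurable (g n) := fun n => (g n).continuous.stronglyMeasurable
  have hlim : Tendsto (fun n => eLpNorm (⇑(g n) - f) 1 μ) atTop (𝓝 0) := by
    refine tendsto_of_tendsto_of_tendsto_of_le_of_le tendsto_const_nhds
      ((tendsto_add_atTop_iff_nat 1).2 ENNReal.tendsto_inv_nat_nhds_zero) (fun _ => zero_le)
      fun n => ?_
    rw [eLpNorm_sub_comm]
    simpa using hg n
  obtain ⟨φ, -, hφ⟩ := (tendstoInMeasure_of_tendsto_eLpNorm one_ne_zero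
    (fun n => (hgm n).aestronglyMeasurable) hfm.aestronglyMeasurable hlim).exists_seq_tendsto_ae
  obtain ⟨s, hs, hμs, hunif⟩ := tendstoUniformlyOn_of_ae_tendsto' (fun n => hgm (φ n)) hfm hφ
    (half_pos hε)
  obtain ⟨K, hKs, hK, hμK⟩ := hs.compl.exists_isClosed_sdiff_lt (measure_ne_top μ _)
    (ENNReal.ofReal_pos.2 (half_pos hε)).ne'
  refine ⟨K, hK, ?_, (hunif.mono hKs).continuousOn
    (Frequently.of_forall fun n => (g (φ n)).continuous.continuousOn)⟩
  calc μ Kᶜ ≤ μ (s ∪ (sᶜ \ K)) := measure_mono fun t ht => by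
        by_cases hts : t ∈ s
        · exact Or.inl hts
        · exact Or.inr ⟨hts, ht⟩
    _ ≤ ENNReal.ofReal (ε / 2) + ENNReal.ofReal (ε / 2) :=
        (measure_union_le _ _).trans (add_le_add hμs hμK.le)
    _ = ENNReal.ofReal ε := by
        rw [← ENNReal.ofReal_add (half_pos hε).le (half_pos hε).le, add_halves]

theorem BoundedVariationOn.countable_not_continuousAt {α E : Type*} [LinearOrder α]
    [TopologicalSpace α] [OrderTopology α] [SecondCountableTopology α] [PseudoMetricSpace E]
    {f : α → E} (hf : BoundedVariationOn f univ) : {t | ¬ContinuousAt f t}.Countable := by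
  rcases isEmpty_or_nonempty α with h | ⟨⟨c⟩⟩
  · exact Set.to_countable _
  let V : α → ℝ := variationOnFromTo f univ c
  have hloc := hf.locallyBoundedVariationOn
  have hV : Monotone V := monotoneOn_univ.1 (variationOnFromTo.monotoneOn hloc (mem_univ c))
  have hle : ∀ s t, s ≤ t → dist (f s) (f t) ≤ V t - V s := fun s t hst => by
    have hadd : V s + variationOnFromTo f univ s t = V t :=
      variationOnFromTo.add hloc (mem_univ c) (mem_univ s) (mem_univ t)
    rw [← hadd, add_sub_cancel_left, variationOnFromTo.eq_of_le f univ hst]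
    exact (hf.mono inter_subset_left).dist_le ⟨mem_univ s, le_rfl, hst⟩ ⟨mem_univ t, hst, le_rfl⟩
  have hdist : ∀ s t, dist (f s) (f t) ≤ dist (V s) (V t) := fun s t => by
    rcases le_total s t with hst | hst
    · rw [dist_comm (V s), Real.dist_eq]
      exact (hle s t hst).trans (le_abs_self _)
    · rw [dist_comm (f s), Real.dist_eq]
      exact (hle t s hst).trans (le_abs_self _)
  refine hV.countable_not_continuousAt.mono fun t (ht : ¬ContinuousAt f t) =>
    show ¬ContinuousAt V t from fun hVt => ht ?_
  exact tendsto_iff_dist_tendsto_zero.2 (squeeze_zero (fun _ => dist_nonneg) (fun s => hdist s t)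
    (tendsto_iff_dist_tendsto_zero.1 hVt))

theorem BoundedVariationOn.stronglyMeasurable {α E : Type*} [LinearOrder α]
    [TopologicalSpace α] [OrderTopology α] [SecondCountableTopology α] [MeasurableSpace α]
    [BorelSpace α] [PseudoMetricSpace E] {f : α → E} (hf : BoundedVariationOn f univ) :
    StronglyMeasurable f :=
  .of_countable_not_continuousAt hf.countable_not_continuousAt

theorem BoundedVariationOn.isBounded_range {α E : Type*} [LinearOrder α] [PseudoMetricSpace E]
    {f : α → E} (hf : BoundedVariationOn f univ) : Bornology.IsBounded (range f) :=
  Metric.isBounded_range_iff.2 ⟨_, fun s t => hf.dist_le (mem_univ s) (mem_univ t)⟩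

/-! ### From continuous selections to pointwise inequalities -/

section Localisation

variable {X H : Type*} [TopologicalSpace X] [CompactSpace X] [T2Space X]
  [SecondCountableTopology X] [MeasurableSpace X] [BorelSpace X]
  [NormedAddCommGroup H] [InnerProductSpace ℝ H] {ν : Measure X}

theorem MeasureTheory.Integrable.inner_of_isBounded_range {X H : Type*} [MeasurableSpace X]
    [NormedAddCommGroup H] [InnerProductSpace ℝ H] {ν : Measure X} {v w : X → H}
    (hv : Integrable v ν) (hw : AEStronglyMeasurable w ν) (hb : Bornology.IsBounded (range w)) :
    Integrable (fun t => ⟪v t, w t⟫) ν := by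
  obtain ⟨M, hM⟩ := hb.exists_norm_le
  refine (hv.norm.mul_const M).mono' (hv.aestronglyMeasurable.inner hw)
    (Eventually.of_forall fun t => ?_)
  exact (norm_inner_le_norm _ _).trans
    (mul_le_mul_of_nonneg_left (hM _ (mem_range_self t)) (norm_nonneg _))

theorem Bornology.IsBounded.range_sub {X H : Type*} [SeminormedAddCommGroup H] {f g : X → H}
    (hf : IsBounded (range f)) (hg : IsBounded (range g)) :
    IsBounded (range fun t => f t - g t) :=
  (hf.sub hg).subset (range_subset_iff.2 fun t => sub_mem_sub (mem_range_self t) (mem_range_self t))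

variable [CompleteSpace H] [IsFiniteMeasure ν] [ν.WeaklyRegular] {F : X → Set H}

/-- By Lusin's theorem a bounded measurable selection `f` agrees off a small set with a continuous
selection, which by the bound on the distance to `y₀` contributes little on the exceptional set. -/
theorem LowerHemicontinuous.integral_inner_nonneg_of_stronglyMeasurable
    (hF : LowerHemicontinuous F) (hconv : ∀ t, Convex ℝ (F t)) (hclosed : ∀ t, IsClosed (F t))
    {v x : X → H} (hv : Integrable v ν) (hx : StronglyMeasurable x)
    (hxb : Bornology.IsBounded (range x))
    (h : ∀ y : C(X, H), (∀ t, y t ∈ F t) → 0 ≤ ∫ t, ⟪v t, y t - x t⟫ ∂ν)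
    {f : X → H} (hf : StronglyMeasurable f) (hfb : Bornology.IsBounded (range f))
    (hfF : ∀ t, f t ∈ F t) : 0 ≤ ∫ t, ⟪v t, f t - x t⟫ ∂ν := by
  obtain ⟨y₀, hy₀⟩ := hF.exists_continuous_selection (fun t => ⟨f t, hfF t⟩) hconv hclosed
  have hcb : ∀ y : C(X, H), Bornology.IsBounded (range y) :=
    fun y => (isCompact_range y.continuous).isBounded
  obtain ⟨R, hR, hfR⟩ : ∃ R > 0, ∀ t, dist (f t) (y₀ t) < R := by
    obtain ⟨R, hR, hfR⟩ := (hfb.range_sub (hcb y₀)).exists_pos_norm_lt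
    exact ⟨R, hR, fun t => by rw [dist_eq_norm]; exact hfR _ (mem_range_self t)⟩
  refine le_of_forall_pos_le_add fun ε hε => ?_
  obtain ⟨δ, hδ, hsmall⟩ := exists_pos_setLIntegral_lt_of_measure_lt
    hv.hasFiniteIntegral.ne (ε := ENNReal.ofReal (ε / (2 * R)))
    (ENNReal.ofReal_pos.2 (by positivity)).ne'
  obtain ⟨η, hη, hηδ⟩ : ∃ η : ℝ, 0 < η ∧ ENNReal.ofReal η < δ := by
    obtain ⟨η, hη, hηδ⟩ := ENNReal.lt_iff_exists_nnreal_btwn.1 hδ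
    exact ⟨η, by simpa using hη, by simpa using hηδ⟩
  have hfi : Integrable f ν := by
    obtain ⟨M, hM⟩ := hfb.exists_norm_le
    exact Integrable.of_bound hf.aestronglyMeasurable M
      (Eventually.of_forall fun t => hM _ (mem_range_self t))
  obtain ⟨K, hK, hνK, hfK⟩ := hfi.exists_isClosed_continuousOn hf hη
  obtain ⟨y, hyF, hyK, hyR⟩ := hF.exists_continuous_selection_extension hconv hclosed hy₀ hK hfK
    (fun t _ => hfF t) hR (fun t _ => hfR t)
  have hym : StronglyMeasurable y := y.continuous.stronglyMeasurable
  have hi₁ : Integrable (fun t => ⟪v t, f t - x t⟫) ν :=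
    hv.inner_of_isBounded_range (hf.sub hx).aestronglyMeasurable (hfb.range_sub hxb)
  have hi₂ : Integrable (fun t => Kᶜ.indicator (fun t => ‖v t‖ * (2 * R)) t) ν :=
    (hv.norm.mul_const _).indicator hK.measurableSet.compl
  have hpt : ∀ t, ⟪v t, y t - x t⟫ ≤
      ⟪v t, f t - x t⟫ + Kᶜ.indicator (fun t => ‖v t‖ * (2 * R)) t := fun t => by
    by_cases ht : t ∈ K
    · simp [hyK ht, ht]
    · have hyf : ‖y t - f t‖ ≤ 2 * R := by
        rw [← dist_eq_norm]
        linarith [dist_triangle_right (y t) (f t) (y₀ t), hyR t, hfR t]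
      rw [indicator_of_mem (show t ∈ Kᶜ from ht), ← sub_le_iff_le_add', ← inner_sub_right,
        sub_sub_sub_cancel_right]
      exact (real_inner_le_norm _ _).trans (mul_le_mul_of_nonneg_left hyf (norm_nonneg _))
  have hKc : ∫ t in Kᶜ, ‖v t‖ ∂ν ≤ ε / (2 * R) := by
    rw [integral_norm_eq_lintegral_enorm hv.aestronglyMeasurable.restrict]
    exact ENNReal.toReal_le_of_le_ofReal (by positivity) (hsmall _ (hνK.trans_lt hηδ)).le
  calc 0 ≤ ∫ t, ⟪v t, y t - x t⟫ ∂ν := h y hyF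
    _ ≤ ∫ t, (⟪v t, f t - x t⟫ + Kᶜ.indicator (fun t => ‖v t‖ * (2 * R)) t) ∂ν :=
        integral_mono (hv.inner_of_isBounded_range (hym.sub hx).aestronglyMeasurable
          ((hcb y).range_sub hxb)) (hi₁.add hi₂) hpt
    _ = ∫ t, ⟪v t, f t - x t⟫ ∂ν + (∫ t in Kᶜ, ‖v t‖ ∂ν) * (2 * R) := by
        rw [integral_add hi₁ hi₂, integral_indicator hK.measurableSet.compl, integral_mul_const]
    _ ≤ ∫ t, ⟪v t, f t - x t⟫ ∂ν + ε := by
        gcongr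
        exact (le_div_iff₀ (by positivity)).1 hKc

/-- The integral inequality localises: it may be tested with the measurable selection that equals
`y` where the integrand is negative and `x` elsewhere. -/
theorem LowerHemicontinuous.ae_inner_nonneg_of_continuous_selection
    (hF : LowerHemicontinuous F) (hconv : ∀ t, Convex ℝ (F t)) (hclosed : ∀ t, IsClosed (F t))
    {v x : X → H} (hv : Integrable v ν) (hx : StronglyMeasurable x)
    (hxb : Bornology.IsBounded (range x)) (hxF : ∀ t, x t ∈ F t)
    (h : ∀ y : C(X, H), (∀ t, y t ∈ F t) → 0 ≤ ∫ t, ⟪v t, y t - x t⟫ ∂ν)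
    (y : C(X, H)) (hy : ∀ t, y t ∈ F t) : ∀ᵐ t ∂ν, 0 ≤ ⟪v t, y t - x t⟫ := by
  classical
  obtain ⟨w, hw, hvw⟩ := hv.aestronglyMeasurable
  have hym : StronglyMeasurable y := y.continuous.stronglyMeasurable
  let A : Set X := {t | ⟪w t, y t - x t⟫ < 0}
  have hA : MeasurableSet A :=
    (StronglyMeasurable.inner (𝕜 := ℝ) hw (hym.sub hx)).measurable measurableSet_Iio
  have hfb : Bornology.IsBounded (range (A.piecewise y x)) := by
    refine ((isCompact_range y.continuous).isBounded.union hxb).subset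
      (range_subset_iff.2 fun t => ?_)
    by_cases ht : t ∈ A <;> simp [ht]
  have hf := hF.integral_inner_nonneg_of_stronglyMeasurable hconv hclosed hv hx hxb h
    (hym.piecewise hA hx) hfb (fun t => by by_cases ht : t ∈ A <;> simp [ht, hxF t, hy t])
  have hi : Integrable (fun t => ⟪v t, A.piecewise y x t - x t⟫) ν :=
    hv.inner_of_isBounded_range ((hym.piecewise hA hx).sub hx).aestronglyMeasurable
      (hfb.range_sub hxb)
  have hneg : 0 ≤ᵐ[ν] fun t => -⟪v t, A.piecewise y x t - x t⟫ := by
    filter_upwards [hvw] with t ht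
    by_cases htA : t ∈ A
    · have : ⟪w t, y t - x t⟫ < 0 := htA
      simpa [htA, ht] using this.le
    · simp [htA]
  have hzero : ∫ t, -⟪v t, A.piecewise y x t - x t⟫ ∂ν = 0 := by
    refine le_antisymm ?_ (integral_nonneg_of_ae hneg)
    rw [integral_neg]
    linarith
  filter_upwards [hvw, (integral_eq_zero_iff_of_nonneg_ae hneg hi.neg).1 hzero] with t ht ht₀
  by_cases htA : t ∈ A
  · have : ⟪v t, y t - x t⟫ = 0 := by simpa [htA] using ht₀
    exact this.ge
  · rw [ht]
    exact not_lt.1 htA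

/-- The exceptional null set can be chosen independently of the selection. Each point of each
`F t` lies on a continuous selection, and since `v` and `x` have essentially separable range, the
Lindelöf property leaves countably many selections to be considered; `H` itself need not be
separable. -/
theorem LowerHemicontinuous.ae_forall_mem_inner_nonneg
    (hF : LowerHemicontinuous F) (hconv : ∀ t, Convex ℝ (F t)) (hclosed : ∀ t, IsClosed (F t))
    {v x : X → H} (hv : Integrable v ν) (hx : StronglyMeasurable x)
    (hxb : Bornology.IsBounded (range x)) (hxF : ∀ t, x t ∈ F t)
    (h : ∀ y : C(X, H), (∀ t, y t ∈ F t) → 0 ≤ ∫ t, ⟪v t, y t - x t⟫ ∂ν) :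
    ∀ᵐ t ∂ν, ∀ z ∈ F t, 0 ≤ ⟪v t, z - x t⟫ := by
  obtain ⟨w, hw, hvw⟩ := hv.aestronglyMeasurable
  let p : X → X × H × H := fun t => (t, w t, x t)
  have hp : StronglyMeasurable p :=
    continuous_id.stronglyMeasurable.prodMk (hw.prodMk hx)
  have := hp.isSeparable_range.secondCountableTopology
  let U : {y : C(X, H) // ∀ t, y t ∈ F t} → Set (range p) :=
    fun y => {q | ⟪q.1.2.1, y.1 q.1.1 - q.1.2.2⟫ < 0}
  have hU : ∀ y, IsOpen (U y) := fun y => by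
    refine isOpen_lt ?_ continuous_const
    have := y.1.continuous
    fun_prop
  obtain ⟨T, hT, hTU⟩ := TopologicalSpace.isOpen_iUnion_countable U hU
  have hae : ∀ᵐ t ∂ν, ∀ y ∈ T, 0 ≤ ⟪v t, y.1 t - x t⟫ := (ae_ball_iff hT).2 fun y _ =>
    hF.ae_inner_nonneg_of_continuous_selection hconv hclosed hv hx hxb hxF h y.1 y.2
  obtain ⟨y₀, hy₀⟩ := hF.exists_continuous_selection (fun t => ⟨x t, hxF t⟩) hconv hclosed
  filter_upwards [hvw, hae] with t ht htT z hz
  by_contra! hneg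
  obtain ⟨y, hyF, hyz, -⟩ := hF.exists_continuous_selection_extension hconv hclosed hy₀
    (isClosed_singleton (x := t)) (f := fun _ => z) continuousOn_const
    (by rintro _ rfl; exact hz) (R := dist z (y₀ t) + 1) (by positivity)
    (by rintro _ rfl; exact lt_add_one _)
  have hmem : (⟨p t, mem_range_self t⟩ : range p) ∈ ⋃ y, U y := by
    refine mem_iUnion.2 ⟨⟨y, hyF⟩, ?_⟩
    change ⟪w t, y t - x t⟫ < 0
    rwa [hyz (mem_singleton t), ← ht]
  rw [← hTU] at hmem
  obtain ⟨y', hy'T, hy'⟩ := mem_iUnion₂.1 hmem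
  have hlt : ⟪w t, y'.1 t - x t⟫ < 0 := hy'
  rw [← ht] at hlt
  exact (htT y' hy'T).not_gt hlt

end Localisation

/-! ### The two notions of solution -/

/-- Pointwise integration of the normal cone inequality. The integrand is integrable whenever `y`
is continuous, since `v` is integrable and `x`, `y` are bounded and measurable, so the integral
has its usual meaning. -/
theorem SweepingProcess.IsDifferentialMeasureSolution.isIntegralSolution {H : Type*}
    [NormedAddCommGroup H] [InnerProductSpace ℝ H] [CompleteSpace H] {a b : ℝ} {hab : a ≤ b}
    {C : Set.Icc a b → Set H} {x₀ : H} {x : Set.Icc a b → H}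
    (h : IsDifferentialMeasureSolution hab C x₀ x) : IsIntegralSolution hab C x₀ x := by
  obtain ⟨hx, ν, hν, v, hv, hN⟩ := h
  refine ⟨hx, ν, hν, v, hv, fun y hy => integral_nonneg_of_ae ?_⟩
  filter_upwards [hN, hy] with t ht hyt
  simpa using ht.2 _ hyt

/-- The measure `ν` and the density `v` of the integral solution serve unchanged. -/
theorem SweepingProcess.IsIntegralSolution.isDifferentialMeasureSolution {H : Type*}
    [NormedAddCommGroup H] [InnerProductSpace ℝ H] [CompleteSpace H] {a b : ℝ} {hab : a ≤ b}
    {C : Set.Icc a b → Set H} (hclosed : ∀ t, IsClosed (C t)) (hconv : ∀ t, Convex ℝ (C t))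
    (hC : LowerHemicontinuous C) {x₀ : H} {x : Set.Icc a b → H}
    (h : IsIntegralSolution hab C x₀ x) : IsDifferentialMeasureSolution hab C x₀ x := by
  obtain ⟨hx, ν, hν, v, hv, hint⟩ := h
  refine ⟨hx, ν, hν, v, hv, ?_⟩
  filter_upwards [hC.ae_forall_mem_inner_nonneg hconv hclosed hv.1
    hx.boundedVariation.stronglyMeasurable hx.boundedVariation.isBounded_range hx.mem
    fun y hy => hint y (Eventually.of_forall hy)] with t ht
  exact ⟨hx.mem t, fun z hz => by simpa using ht z hz⟩

theorem mainTheorem10 {H : Type*} [NormedAddCommGroup H] [InnerProductSpace ℝ H] [CompleteSpace H]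
    {a b : ℝ} (hab : a ≤ b) (C : Set.Icc a b → Set H)
    (hC_nonempty : ∀ t, (C t).Nonempty) (hC_closed : ∀ t, IsClosed (C t))
    (hC_convex : ∀ t, Convex ℝ (C t)) (hC_bounded : ∀ t, Bornology.IsBounded (C t))
    (x₀ : H) (x : Set.Icc a b → H) :
    (SweepingProcess.IsDifferentialMeasureSolution hab C x₀ x →
        SweepingProcess.IsIntegralSolution hab C x₀ x) ∧
      (LowerHemicontinuous C →
        (SweepingProcess.IsIntegralSolution hab C x₀ x ↔
          SweepingProcess.IsDifferentialMeasureSolution hab C x₀ x)) :=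
  ⟨fun h => h.isIntegralSolution, fun hC =>
    ⟨fun h => h.isDifferentialMeasureSolution hC_closed hC_convex hC, fun h => h.isIntegralSolution⟩⟩
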